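/- Let $\mathbb{K}=\mathbb{R}$ or $\mathbb{C}$. Let $2Nilp_8(\mathbb{K})$ be the algebraic variety of Lie brackets $\mu$ on $\mathbb{K}^8$ with $\mu(x,\mu(y,z))=0$ for all $x,y,z$ (at most $2$-step nilpotent Lie brackets), regarded as a subset of the affine space of structure constants $(C_{ij}^k)\in\mathbb{K}^{8\times 8\times 8}$, $\mu(e_i,e_j)=\sum_k C_{ij}^k e_k$. The group $GL_8(\mathbb{K})$ acts on it by $(g\cdot\mu)(x,y)=g\,\mu(g^{-1}x,g^{-1}y)$; the orbit of $\mu$ consists of the brackets isomorphic to $\mu$. Let $\mathfrak{k}_8$ be the Lie algebra on $\mathbb{K}^8$, with standard basis $X_1,\dots,X_8$ and dual basis $\alpha_1,\dots,\alpha_8$, defined by the Maurer–Cartan equations $$d\alpha_3=\alpha_1\wedge\alpha_2+\alpha_4\wedge\alpha_6+\alpha_7\wedge\alpha_8,\qquad d\alpha_5=\alpha_1\wedge\alpha_4+\alpha_2\wedge\alpha_8+\alpha_6\wedge\alpha_7,\qquad d\alpha_i=0\ (i\neq 3,5),$$ where $d\alpha(X,Y)=-\alpha([X,Y])$. **Proposition.**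 The Lie algebra $\mathfrak{k}_8$ is rigid in $2Nilp_8$, that is, its orbit is open. More precisely, for $\mathbb{K}=\mathbb{C}$ the orbit of $\mathfrak{k}_8$ is open in $2Nilp_8(\mathbb{C})$ for the Zariski topology and for the classical (metric) topology, and for $\mathbb{K}=\mathbb{R}$ the orbit of $\mathfrak{k}_8$ is open in $2Nilp_8(\mathbb{R})$ for the classical topology. -/

import Mathlib

open scoped Topology

noncomputable section

/-- The underlying vector space `K^n`. -/
abbrev Vec (K : Type*) (n : ℕ) : Type _ := Fin n → K

/-- Bilinear products `K^n × K^n → K^n`. -/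
abbrev BilinProduct (K : Type*) [Field K] (n : ℕ) : Type _ :=
  Vec K n →ₗ[K] Vec K n →ₗ[K] Vec K n

/-- `μ` is a Lie bracket on `K^n`: it is alternating and satisfies the Jacobi identity. -/
structure IsLieBracket {K : Type*} [Field K] {n : ℕ} (μ : BilinProduct K n) : Prop where
  alt : ∀ x, μ x x = 0
  jacobi : ∀ x y z, μ (μ x y) z + μ (μ y z) x + μ (μ z x) y = 0

/-- The set `2Nilp_n` of Lie brackets `μ` on `K^n` with `C^2(μ) = [K^n, [K^n, K^n]] = 0`.
The abelian bracket is included, which makes this an algebraic variety. -/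
def TwoNilp (K : Type*) [Field K] (n : ℕ) : Type _ :=
  {μ : BilinProduct K n // IsLieBracket μ ∧ ∀ x y z, μ x (μ y z) = 0}

/-- Index set of the structure constants. -/
abbrev StrIndex (n : ℕ) : Type := Fin n × Fin n × Fin n

/-- The structure constants `C_{ij}^k` of `μ`, given by `μ(e_i, e_j) = ∑ k, C_{ij}^k e_k`. -/
def strConst {K : Type*} [Field K] {n : ℕ} (μ : BilinProduct K n) : StrIndex n → K :=
  fun t => μ (Pi.single t.1 1) (Pi.single t.2.1 1) t.2.2

/-- The Zariski topology on the affine space `K^σ`: the closed sets are the sets of common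
zeros of families of polynomials. -/
abbrev zariskiAffine (σ K : Type*) [Field K] : TopologicalSpace (σ → K) :=
  TopologicalSpace.ofClosed
    {Z | ∃ S : Set (MvPolynomial σ K), Z = {x | ∀ p ∈ S, MvPolynomial.eval x p = 0}}
    ⟨{1}, by ext x; simp⟩
    (by
      intro A hA
      refine ⟨{p | ∃ Z ∈ A, ∀ x ∈ Z, MvPolynomial.eval x p = 0}, ?_⟩
      ext x
      constructor
      · rintro hx p ⟨Z, hZ, hp⟩
        exact hp x (hx Z hZ)
      · intro hx Z hZ
        obtain ⟨S, hS⟩ := hA hZ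
        subst hS
        exact fun p hp => hx p ⟨_, hZ, fun y hy => hy p hp⟩)
    (by
      rintro _ ⟨S, rfl⟩ _ ⟨T, rfl⟩
      refine ⟨{r | ∃ p ∈ S, ∃ q ∈ T, r = p * q}, ?_⟩
      ext x
      constructor
      · rintro (h | h) _ ⟨p, hp, q, hq, rfl⟩
        · rw [map_mul, h p hp, zero_mul]
        · rw [map_mul, h q hq, mul_zero]
      · intro h
        by_contra hc
        simp only [Set.mem_union, Set.mem_ofPred_eq, not_or, not_forall] at hc
        obtain ⟨⟨p, hp, hp'⟩, q, hq, hq'⟩ := hc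
        have := h (p * q) ⟨p, hp, q, hq, rfl⟩
        rw [map_mul] at this
        exact mul_ne_zero hp' hq' this)

namespace TwoNilp

variable {K : Type*} [Field K] {n : ℕ}

/-- The Zariski topology of `2Nilp_n`, as a subset of the space of structure constants. -/
abbrev zariski (K : Type*) [Field K] (n : ℕ) : TopologicalSpace (TwoNilp K n) :=
  TopologicalSpace.induced (fun μ => strConst μ.1) (zariskiAffine (StrIndex n) K)

/-- The classical (metric) topology of `2Nilp_n`, as a subset of the space of structure
constants with the product topology. -/
abbrev classical (K : Type*) [Field K] [TopologicalSpace K] (n : ℕ) :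
    TopologicalSpace (TwoNilp K n) :=
  TopologicalSpace.induced (fun μ => strConst μ.1) Pi.topologicalSpace

/-- The orbit of `μ` under `GL(K^n)`: all brackets `(x, y) ↦ g (μ (g⁻¹ x, g⁻¹ y))`. -/
def orbit (μ : TwoNilp K n) : Set (TwoNilp K n) :=
  {ν | ∃ g : Vec K n ≃ₗ[K] Vec K n, ∀ x y, ν.1 x y = g (μ.1 (g.symm x) (g.symm y))}

end TwoNilp

/-- The 2-form `α_i ∧ α_j` on `K^8`, where `α_1, …, α_8` is the dual of the standard basis
`X_1, …, X_8`. The labels `1, …, 8` correspond to `0, …, 7` in `Fin 8`. -/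
def wedge {K : Type*} [Field K] (i j : Fin 8) (x y : Vec K 8) : K :=
  x i * y j - x j * y i

/-- `dα_3 = α_1 ∧ α_2 + α_4 ∧ α_6 + α_7 ∧ α_8`. -/
def dAlpha3 {K : Type*} [Field K] (x y : Vec K 8) : K :=
  wedge 0 1 x y + wedge 3 5 x y + wedge 6 7 x y

/-- `dα_5 = α_1 ∧ α_4 + α_2 ∧ α_8 + α_6 ∧ α_7`. -/
def dAlpha5 {K : Type*} [Field K] (x y : Vec K 8) : K :=
  wedge 0 3 x y + wedge 1 7 x y + wedge 5 6 x y

/-- The bracket with Maurer-Cartan equations `dα_3`, `dα_5` as above and `dα_i = 0` for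
`i ≠ 3, 5`. Since `dα(X, Y) = -α([X, Y])`, it is `[x, y] = -dα_3(x, y) X_3 - dα_5(x, y) X_5`. -/
def k8Bracket (K : Type*) [Field K] : BilinProduct K 8 :=
  LinearMap.mk₂ K
    (fun x y => -(dAlpha3 x y) • Pi.single (2 : Fin 8) (1 : K)
      - dAlpha5 x y • Pi.single (4 : Fin 8) (1 : K))
    (by intro x x' y; simp only [dAlpha3, dAlpha5, wedge, Pi.add_apply]; module)
    (by intro c x y; simp only [dAlpha3, dAlpha5, wedge, Pi.smul_apply, smul_eq_mul]; module)
    (by intro x y y'; simp only [dAlpha3, dAlpha5, wedge, Pi.add_apply]; module)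
    (by intro c x y; simp only [dAlpha3, dAlpha5, wedge, Pi.smul_apply, smul_eq_mul]; module)

theorem k8Bracket_apply {K : Type*} [Field K] (x y : Vec K 8) :
    k8Bracket K x y = -(dAlpha3 x y) • Pi.single (2 : Fin 8) (1 : K)
      - dAlpha5 x y • Pi.single (4 : Fin 8) (1 : K) := rfl

theorem k8Bracket_two_step {K : Type*} [Field K] (x y z : Vec K 8) :
    k8Bracket K x (k8Bracket K y z) = 0 := by
  simp [k8Bracket_apply, dAlpha3, dAlpha5, wedge]

theorem k8Bracket_two_step' {K : Type*} [Field K] (x y z : Vec K 8) :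
    k8Bracket K (k8Bracket K x y) z = 0 := by
  simp [k8Bracket_apply, dAlpha3, dAlpha5, wedge]

theorem k8Bracket_isLieBracket (K : Type*) [Field K] : IsLieBracket (k8Bracket K) where
  alt x := by simp [k8Bracket_apply, dAlpha3, dAlpha5, wedge, mul_comm]
  jacobi x y z := by simp [k8Bracket_two_step']

/-- The Lie algebra `𝔨_8` as a point of `2Nilp_8`. -/
def k8 (K : Type*) [Field K] : TwoNilp K 8 :=
  ⟨k8Bracket K, k8Bracket_isLieBracket K, k8Bracket_two_step⟩

end

/-! The two components of the bracket of an algebra close to `𝔨₈` form a pencil `A`, `B` of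
alternating forms on `K ^ 6`, and `B = A (·) (T ·)` for an `A`-self-adjoint operator `T`. Such a `T`
is annihilated by a cubic, whose coefficients are polynomials in the moments `A e (T ^ n e')` and
which is `-(X³ + 1)` for `𝔨₈`. A cubic `p` over a field with cube roots is a sum of cubes `m³ + n³`
of two independent linear forms as soon as its Hessian splits, that is as soon as `-3 disc p` is a
nonzero square. The six vectors `n² u, n m u, m² u` and `n² w, n m w, m² w` at `T`, with `u` cyclic
and `w` chosen dual to it, then exhibit the Maurer–Cartan equations of `𝔨₈`. All conditions used
hold on a neighbourhood of `𝔨₈`, and the action of `GL₈` moves this neighbourhood along the orbit.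
-/

open Polynomial

section SelfAdjoint

variable {R M : Type*} [CommRing R] [AddCommGroup M] [Module R M]
  {A B : LinearMap.BilinForm R M} {S T : Module.End R M}

theorem isAdjointPair_pow (h : LinearMap.IsAdjointPair A A S T) (k : ℕ) :
    LinearMap.IsAdjointPair A A (S ^ k : Module.End R M) (T ^ k : Module.End R M) := by
  induction k with
  | zero => simpa only [pow_zero] using LinearMap.isAdjointPair_one
  | succ k ih => simpa only [pow_succ S, pow_succ' T] using ih.mul h

theorem isAdjointPair_aeval (h : LinearMap.IsAdjointPair A A S T) (p : R[X]) :
    LinearMap.IsAdjointPair A A (aeval S p) (aeval T p) := by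
  induction p using Polynomial.induction_on' with
  | add p q hp hq => rw [map_add, map_add]; exact hp.add hq
  | monomial k a =>
    rw [aeval_monomial, aeval_monomial, ← Algebra.smul_def, ← Algebra.smul_def]
    exact (isAdjointPair_pow h k).smul a

theorem apply_aeval_aeval (hT : A.IsSelfAdjoint T) (p q : R[X]) (x y : M) :
    A (aeval T p x) (aeval T q y) = A x (aeval T (p * q) y) := by
  rw [isAdjointPair_aeval hT p x, map_mul, Module.End.mul_apply]

theorem isSelfAdjoint_of_apply_eq_mul (hA : A.IsAlt) (hB : B.IsAlt) {d : R}
    (h : ∀ x y, A x (T y) = d * B x y) : A.IsSelfAdjoint T := fun x y => by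
  rw [← hA.neg_eq, h, h, ← hB.neg_eq x y, mul_neg, neg_neg]

theorem apply_apply_self_eq_zero [NoZeroDivisors R] [NeZero (2 : R)] (hA : A.IsAlt)
    (hT : A.IsSelfAdjoint T) (x : M) : A x (T x) = 0 := by
  have eq_neg : A x (T x) = -A x (T x) := by rw [hA.neg_eq, hT x x]
  have two_mul_eq_zero : 2 * A x (T x) = 0 := by linear_combination eq_neg
  exact (mul_eq_zero.1 two_mul_eq_zero).resolve_left two_ne_zero

theorem apply_aeval_aeval_self [NoZeroDivisors R] [NeZero (2 : R)] (hA : A.IsAlt)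
    (hT : A.IsSelfAdjoint T) (p q : R[X]) (x : M) : A (aeval T p x) (aeval T q x) = 0 := by
  rw [apply_aeval_aeval hT]
  exact apply_apply_self_eq_zero hA (isAdjointPair_aeval hT _) x

theorem linearIndependent_sum_of_isotropic [IsDomain R] {ι : Type*} [Fintype ι] [DecidableEq ι]
    {x y : ι → M} (hx : ∀ i j, A (x i) (x j) = 0) (hy : ∀ i j, A (y i) (y j) = 0)
    (hdet : (Matrix.of fun i j => A (x i) (y j)).det ≠ 0) :
    LinearIndependent R (Sum.elim x y) := by
  refine Fintype.linearIndependent_iff.2 fun c hc => ?_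
  simp only [Fintype.sum_sum_type, Sum.elim_inl, Sum.elim_inr] at hc
  have inl_eq_zero : c ∘ Sum.inl = 0 := by
    refine Matrix.eq_zero_of_vecMul_eq_zero hdet (funext fun j => ?_)
    simpa [hy, Matrix.vecMul, dotProduct] using congrArg (A · (y j)) hc
  have inr_eq_zero : c ∘ Sum.inr = 0 := by
    refine Matrix.eq_zero_of_mulVec_eq_zero hdet (funext fun i => ?_)
    simpa [hx, Matrix.mulVec, dotProduct, mul_comm] using congrArg (A (x i)) hc
  exact Sum.rec (congrFun inl_eq_zero) (congrFun inr_eq_zero)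

end SelfAdjoint

section Recurrence

variable {R S : Type*} [CommRing R] [CommRing S]

/-- The `n × n` Hankel matrix `(h (i + j))` of a sequence of moments `h`. -/
def hankel {R : Type*} (h : ℕ → R) (n : ℕ) : Matrix (Fin n) (Fin n) R :=
  Matrix.of fun i j => h (i + j)

/-- The cubic which annihilates a linear recurrent sequence `h` of order three, scaled by the
determinant of the Hankel matrix so that its coefficients are polynomials in `h 0, …, h 5`. -/
def recurrenceCubic (h : ℕ → R) : Cubic R :=
  let k := (hankel h 3).cramer fun i => h (i + 3)
  ⟨(hankel h 3).det, -k 2, -k 1, -k 0⟩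

theorem recurrenceCubic_recurrence (h : ℕ → R) (j : Fin 3) :
    (recurrenceCubic h).d * h j + (recurrenceCubic h).c * h (j + 1) +
      (recurrenceCubic h).b * h (j + 2) + (recurrenceCubic h).a * h (j + 3) = 0 := by
  have cramer_apply := congrFun ((hankel h 3).mulVec_cramer fun i => h (i + 3)) j
  simp only [Matrix.mulVec, dotProduct, Fin.sum_univ_three, hankel, Matrix.of_apply,
    Pi.smul_apply, smul_eq_mul, Fin.val_zero, Fin.val_one, Fin.val_two, add_zero] at cramer_apply
  simp only [recurrenceCubic, hankel]
  linear_combination -cramer_apply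

theorem map_hankel {R S : Type*} (f : R → S) (h : ℕ → R) (n : ℕ) :
    (hankel h n).map f = hankel (f ∘ h) n := rfl

theorem map_recurrenceCubic (f : R →+* S) (h : ℕ → R) :
    (recurrenceCubic h).map f = recurrenceCubic (f ∘ h) := by
  have map_cramer (i : Fin 3) : f ((hankel h 3).cramer (fun i => h (i + 3)) i) =
      (hankel (f ∘ h) 3).cramer (fun i => f (h (i + 3))) i := by
    rw [Matrix.cramer_apply, Matrix.cramer_apply, f.map_det, RingHom.mapMatrix_apply,
      Matrix.map_updateCol, map_hankel]
    rfl
  ext <;> simp only [Cubic.map, recurrenceCubic, map_neg, map_cramer, Function.comp_apply]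
  exact (f.map_det _)

end Recurrence

section Krylov

theorem linearIndependent_krylov_pair {R M : Type*} [CommRing R] [IsDomain R] [NeZero (2 : R)]
    [AddCommGroup M] [Module R M] {A : LinearMap.BilinForm R M} {T : Module.End R M} {u w : M}
    {n : ℕ} (hA : A.IsAlt) (hT : A.IsSelfAdjoint T)
    (hdet : (hankel (fun k => A u ((T ^ k) w)) n).det ≠ 0) :
    LinearIndependent R (Sum.elim (fun i : Fin n => (T ^ (i : ℕ)) u)
      (fun j : Fin n => (T ^ (j : ℕ)) w)) := by
  have isotropic (x : M) (i j : Fin n) : A ((T ^ (i : ℕ)) x) ((T ^ (j : ℕ)) x) = 0 := by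
    simpa only [aeval_X_pow] using apply_aeval_aeval_self hA hT (X ^ (i : ℕ)) (X ^ (j : ℕ)) x
  refine linearIndependent_sum_of_isotropic (isotropic u) (isotropic w) ?_
  convert hdet using 3
  ext i j
  rw [Matrix.of_apply, isAdjointPair_pow hT, ← Module.End.mul_apply, ← pow_add]
  rfl

variable {K V : Type*} [Field K] [NeZero (2 : K)] [AddCommGroup V] [Module K V]
  {A : LinearMap.BilinForm K V} {T : Module.End K V} {u w : V}

theorem aeval_eq_zero_of_moments_eq_zero {n : ℕ} [NeZero n] (hA : A.IsAlt) (hnd : A.Nondegenerate)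
    (hT : A.IsSelfAdjoint T) (hdim : Module.finrank K V = 2 * n)
    (hdet : (hankel (fun k => A u ((T ^ k) w)) n).det ≠ 0) {p : K[X]}
    (hp : ∀ j : Fin n, A u (aeval T (p * X ^ (j : ℕ)) w) = 0) : aeval T p = 0 := by
  let b := basisOfLinearIndependentOfCardEqFinrank (linearIndependent_krylov_pair hA hT hdet)
    (by rw [hdim, Fintype.card_sum, Fintype.card_fin, two_mul])
  have b_inl (j : Fin n) : b (Sum.inl j) = aeval T (X ^ (j : ℕ) : K[X]) u := by simp [b]
  have b_inr (j : Fin n) : b (Sum.inr j) = aeval T (X ^ (j : ℕ) : K[X]) w := by simp [b]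
  have eq_zero {x : V} (hu : ∀ j : Fin n, A x (aeval T (X ^ (j : ℕ) : K[X]) u) = 0)
      (hw : ∀ j : Fin n, A x (aeval T (X ^ (j : ℕ) : K[X]) w) = 0) : x = 0 := by
    have apply_eq_zero : A x = 0 :=
      b.ext (Sum.rec (fun j => b_inl j ▸ hu j) (fun j => b_inr j ▸ hw j))
    exact hnd.1 x (LinearMap.congr_fun apply_eq_zero)
  have aeval_u : aeval T p u = 0 := eq_zero (fun j => apply_aeval_aeval_self hA hT _ _ u)
    fun j => by rw [apply_aeval_aeval hT, hp]
  have aeval_w : aeval T p w = 0 := eq_zero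
    (fun j => by rw [← hA.neg_eq, apply_aeval_aeval hT, mul_comm, hp, neg_zero])
    fun j => apply_aeval_aeval_self hA hT _ _ w
  have aeval_comm (j : Fin n) (x : V) :
      aeval T p (aeval T (X ^ (j : ℕ) : K[X]) x) = aeval T (X ^ (j : ℕ) : K[X]) (aeval T p x) := by
    rw [← Module.End.mul_apply, ← map_mul, mul_comm, map_mul, Module.End.mul_apply]
  refine b.ext (Sum.rec (fun j => ?_) fun j => ?_)
  · rw [b_inl, aeval_comm, aeval_u, map_zero, LinearMap.zero_apply]
  · rw [b_inr, aeval_comm, aeval_w, map_zero, LinearMap.zero_apply]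

theorem aeval_recurrenceCubic_eq_zero (hA : A.IsAlt) (hnd : A.Nondegenerate)
    (hT : A.IsSelfAdjoint T) (hdim : Module.finrank K V = 6)
    (hdet : (hankel (fun k => A u ((T ^ k) w)) 3).det ≠ 0) :
    aeval T (recurrenceCubic fun k => A u ((T ^ k) w)).toPoly = 0 := by
  refine aeval_eq_zero_of_moments_eq_zero hA hnd hT hdim hdet fun j => ?_
  rw [← recurrenceCubic_recurrence (fun k => A u ((T ^ k) w)) j]
  simp only [Cubic.toPoly, add_mul, mul_assoc, ← pow_add, ← pow_succ', map_add, map_mul, aeval_C,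
    aeval_X_pow, LinearMap.add_apply, Module.End.mul_apply, Module.algebraMap_end_apply, map_smul,
    smul_eq_mul, add_comm _ (j : ℕ)]
  ring

end Krylov

section SumOfCubes

/- `6 * q * y + κ` and `κ * y - 2 * q ^ 2` are proportional to the linear factors of the Hessian of
`y ^ 3 + q * y + r`. -/
theorem mul_depressed_cubic_eq_cube_add_cube {R : Type*} [CommRing R] {q r κ : R}
    (hκ : κ ^ 2 = 18 * r * κ + 12 * q ^ 3) (y : R) :
    18 * κ * (κ ^ 2 + 12 * q ^ 3) * (y ^ 3 + q * y + r) =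
      κ * (6 * q * y + κ) ^ 3 + 18 * (κ * y - 2 * q ^ 2) ^ 3 := by
  linear_combination (-κ ^ 2 - 12 * q ^ 3) * hκ

theorem C_mul_toPoly_eq_depressed {R : Type*} [CommRing R] (P : Cubic R) :
    C (27 * P.a ^ 2) * P.toPoly = (C (3 * P.a) * X + C P.b) ^ 3 +
      C (9 * P.a * P.c - 3 * P.b ^ 2) * (C (3 * P.a) * X + C P.b) +
      C (2 * P.b ^ 3 - 9 * P.a * P.b * P.c + 27 * P.a ^ 2 * P.d) := by
  simp only [Cubic.toPoly, map_add, map_sub, map_mul, map_pow, map_ofNat]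
  ring

theorem exists_hessian_root {R : Type*} [CommRing R] [NoZeroDivisors R] [NeZero (2 : R)]
    {q r d : R} (hd : d ≠ 0) (hdisc : d ^ 2 = 81 * r ^ 2 + 12 * q ^ 3) :
    ∃ κ, κ ≠ 0 ∧ κ ^ 2 = 18 * r * κ + 12 * q ^ 3 ∧ κ ^ 2 + 12 * q ^ 3 ≠ 0 := by
  have two_ne : (2 : R) ≠ 0 := two_ne_zero
  obtain ⟨e, he, hne, hsum⟩ : ∃ e, e ^ 2 = d ^ 2 ∧ e ≠ 0 ∧ 9 * r + e ≠ 0 := by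
    by_cases h : 9 * r + d = 0
    · refine ⟨-d, neg_sq d, neg_ne_zero.2 hd, fun h' => mul_ne_zero two_ne hd ?_⟩
      linear_combination h - h'
    · exact ⟨d, rfl, hd, h⟩
  refine ⟨9 * r + e, hsum, by linear_combination he + hdisc, ?_⟩
  have eq_mul : (9 * r + e) ^ 2 + 12 * q ^ 3 = 2 * ((9 * r + e) * e) := by
    linear_combination -he - hdisc
  exact eq_mul ▸ mul_ne_zero two_ne (mul_ne_zero hsum hne)

theorem exists_toPoly_eq_cube_add_cube {K : Type*} [Field K] [NeZero (2 : K)] [NeZero (3 : K)]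
    (hcube : Function.Surjective fun x : K => x ^ 3)
    (P : Cubic K) (ha : P.a ≠ 0) {s : K} (hs : s ≠ 0) (hdisc : -3 * P.discr = s ^ 2) :
    ∃ m₁ m₀ n₁ n₀ : K, m₁ * n₀ - m₀ * n₁ ≠ 0 ∧
      P.toPoly = (C m₁ * X + C m₀) ^ 3 + (C n₁ * X + C n₀) ^ 3 := by
  have three_ne : (3 : K) ≠ 0 := three_ne_zero
  have eighteen_ne : (18 : K) ≠ 0 := by
    rw [show (18 : K) = 2 * 3 ^ 2 by norm_num]
    exact mul_ne_zero two_ne_zero (pow_ne_zero 2 three_ne)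
  have depressed := C_mul_toPoly_eq_depressed P
  set q := 9 * P.a * P.c - 3 * P.b ^ 2
  set r := 2 * P.b ^ 3 - 9 * P.a * P.b * P.c + 27 * P.a ^ 2 * P.d
  obtain ⟨κ, hκ, hκ_root, hκ_sep⟩ := exists_hessian_root (q := q) (r := r)
    (d := 3 ^ 3 * (P.a * s)) (mul_ne_zero (pow_ne_zero 3 three_ne) (mul_ne_zero ha hs)) (by
      simp only [Cubic.discr] at hdisc
      linear_combination (-729 * P.a ^ 2) * hdisc)
  let l := 18 * κ * (κ ^ 2 + 12 * q ^ 3) * (3 * (3 * P.a) ^ 2)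
  have hl : l ≠ 0 := by simp [l, eighteen_ne, three_ne, hκ, hκ_sep, ha]
  obtain ⟨α, hα⟩ : ∃ α, α ^ 3 = κ / l := hcube _
  obtain ⟨β, hβ⟩ : ∃ β, β ^ 3 = 18 / l := hcube _
  have hα₀ : α ≠ 0 := pow_ne_zero_iff three_ne_zero |>.1 (hα ▸ div_ne_zero hκ hl)
  have hβ₀ : β ≠ 0 := pow_ne_zero_iff three_ne_zero |>.1 (hβ ▸ div_ne_zero eighteen_ne hl)
  refine ⟨α * (6 * q * (3 * P.a)), α * (6 * q * P.b + κ), β * (κ * (3 * P.a)),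
    β * (κ * P.b - 2 * q ^ 2), ?_, ?_⟩
  · have hdet : -(3 * P.a * (α * β) * (κ ^ 2 + 12 * q ^ 3)) ≠ 0 := by
      simp [three_ne, ha, hα₀, hβ₀, hκ_sep]
    convert hdet using 1
    ring
  · have cubes := mul_depressed_cubic_eq_cube_add_cube
      (q := C q) (r := C r) (κ := C κ)
      (by simpa only [map_add, map_mul, map_pow, map_ofNat] using congrArg C hκ_root)
      (C (3 * P.a) * X + C P.b)
    have hα' : C l * C α ^ 3 = C κ := by rw [← C_pow, ← C_mul, hα, mul_div_cancel₀ _ hl]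
    have hβ' : C l * C β ^ 3 = 18 := by
      rw [← C_pow, ← C_mul, hβ, mul_div_cancel₀ _ hl, map_ofNat]
    refine mul_left_cancel₀ (C_ne_zero.2 hl) ?_
    rw [← depressed] at cubes
    simp only [l, map_add, map_sub, map_mul, map_pow, map_ofNat] at cubes hα' hβ' ⊢
    linear_combination cubes - (6 * C q * (3 * C P.a * X + C P.b) + C κ) ^ 3 * hα'
      - (C κ * (3 * C P.a * X + C P.b) - 2 * C q ^ 2) ^ 3 * hβ'

end SumOfCubes

section NormalForm

variable {K V : Type*} [Field K] [AddCommGroup V] [Module K V]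

theorem exists_apply_eq_of_linearIndependent [FiniteDimensional K V] {A : LinearMap.BilinForm K V}
    (hA : A.Nondegenerate) {ι : Type*} [Finite ι] {v : ι → V} (hv : LinearIndependent K v)
    (c : ι → K) : ∃ w, ∀ i, A (v i) w = c i := by
  have := Fintype.ofFinite ι
  classical
  obtain ⟨φ, hφ⟩ := LinearMap.dualMap_surjective_of_injective
    (hv.fintypeLinearCombination_injective) (Fintype.linearCombination K c)
  refine ⟨(A.flip.toDual hA.flip).symm φ, fun i => ?_⟩
  have apply_v := LinearMap.congr_fun hφ (Pi.single i 1)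
  simp only [LinearMap.dualMap_apply, Fintype.linearCombination_apply_single, one_smul] at apply_v
  rw [← apply_v, ← LinearMap.BilinForm.apply_toDual_symm_apply (hB := hA.flip) φ (v i)]
  rfl

theorem isCoprime_linear {m₁ m₀ n₁ n₀ : K} (h : m₁ * n₀ - m₀ * n₁ ≠ 0) :
    IsCoprime (C m₁ * X + C m₀) (C n₁ * X + C n₀) := by
  refine ⟨C (-n₁ / (m₁ * n₀ - m₀ * n₁)), C (m₁ / (m₁ * n₀ - m₀ * n₁)), ?_⟩
  have hC : C (m₁ * n₀ - m₀ * n₁)⁻¹ * C (m₁ * n₀ - m₀ * n₁) = (1 : K[X]) := by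
    rw [← C_mul, inv_mul_cancel₀ h, C_1]
  simp only [div_eq_mul_inv, map_mul, map_sub, map_neg] at hC ⊢
  linear_combination hC

theorem linearIndependent_quadratics {R M : Type*} [CommRing R] [IsDomain R] [AddCommGroup M]
    [Module R M] {T : Module.End R M} {u : M}
    (hu : LinearIndependent R fun i : Fin 3 => (T ^ (i : ℕ)) u)
    {m₁ m₀ n₁ n₀ : R} (hmn : m₁ * n₀ - m₀ * n₁ ≠ 0) :
    LinearIndependent R ![aeval T ((C n₁ * X + C n₀) ^ 2) u,
      aeval T ((C n₁ * X + C n₀) * (C m₁ * X + C m₀)) u, aeval T ((C m₁ * X + C m₀) ^ 2) u] := by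
  rw [Fintype.linearIndependent_iff] at hu ⊢
  intro g hg
  have hcoeff := hu ![g 0 * n₀ ^ 2 + g 1 * (n₀ * m₀) + g 2 * m₀ ^ 2,
    2 * g 0 * (n₀ * n₁) + g 1 * (n₀ * m₁ + n₁ * m₀) + 2 * g 2 * (m₀ * m₁),
    g 0 * n₁ ^ 2 + g 1 * (n₁ * m₁) + g 2 * m₁ ^ 2] (by
      rw [← hg]
      simp only [Fin.sum_univ_three, Matrix.cons_val, Fin.val_zero, Fin.val_one, Fin.val_two,
        pow_two, pow_zero, pow_one, map_add, map_mul, aeval_C, aeval_X, Module.End.mul_apply,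
        LinearMap.add_apply, Module.algebraMap_end_apply, Module.End.one_apply, map_smul]
      module)
  have h₀ := hcoeff 0
  have h₁ := hcoeff 1
  have h₂ := hcoeff 2
  simp only [Matrix.cons_val] at h₀ h₁ h₂
  have cancel {x : R} (h : (m₁ * n₀ - m₀ * n₁) ^ 2 * x = 0) : x = 0 :=
    (mul_eq_zero.1 h).resolve_left (pow_ne_zero 2 hmn)
  have hg₀ : g 0 = 0 := cancel (by
    linear_combination m₁ ^ 2 * h₀ - m₀ * m₁ * h₁ + m₀ ^ 2 * h₂)
  have hg₁ : g 1 = 0 := cancel (by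
    linear_combination -2 * m₁ * n₁ * h₀ + (m₁ * n₀ + m₀ * n₁) * h₁ - 2 * m₀ * n₀ * h₂)
  have hg₂ : g 2 = 0 := cancel (by
    linear_combination n₁ ^ 2 * h₀ - n₀ * n₁ * h₁ + n₀ ^ 2 * h₂)
  exact Fin.forall_fin_succ.2 ⟨hg₀, Fin.forall_fin_two.2 ⟨hg₁, hg₂⟩⟩

theorem exists_krylov_dual_of_cube_add_cube_eq_zero [FiniteDimensional K V]
    {A : LinearMap.BilinForm K V} {T : Module.End K V} {u : V} {m n : K[X]} (hnd : A.Nondegenerate)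
    (hT : A.IsSelfAdjoint T) (hmn : IsCoprime m n) (hcubes : aeval T (m ^ 3 + n ^ 3) = 0)
    (hu : LinearIndependent K ![aeval T (n ^ 2) u, aeval T (n * m) u, aeval T (m ^ 2) u]) :
    ∃ w, ∀ k : Fin 6,
      A u (aeval T (n ^ (5 - k : ℕ) * m ^ (k : ℕ)) w) = (![0, 0, 1, 0, 0, -1] : Fin 6 → K) k := by
  have isCoprime_cubes : IsCoprime (m ^ 3 + n ^ 3) (n ^ 3) := by
    simpa only [mul_one] using hmn.pow.add_mul_left_left 1
  have ker_eq_bot : LinearMap.ker (aeval T (n ^ 3)) = ⊥ := by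
    simpa only [hcubes, LinearMap.ker_zero, top_disjoint] using
      disjoint_ker_aeval_of_isCoprime T isCoprime_cubes
  obtain ⟨w, hw⟩ := exists_apply_eq_of_linearIndependent hnd (hu.map' _ ker_eq_bot) ![0, 0, 1]
  have apply_cube_mul (p : K[X]) :
      A u (aeval T (n ^ 3 * p) w) = A (aeval T (n ^ 3) (aeval T p u)) w := by
    rw [isAdjointPair_aeval hT, isAdjointPair_aeval hT, mul_comm, map_mul, Module.End.mul_apply]
  have apply_cube_mul' (p : K[X]) : A u (aeval T (p * m ^ 3) w) = -A u (aeval T (n ^ 3 * p) w) := by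
    rw [eq_neg_iff_add_eq_zero, ← map_add, ← LinearMap.add_apply, ← map_add, mul_comm, ← add_mul,
      map_mul, hcubes, zero_mul, LinearMap.zero_apply, map_zero]
  have h₀ : A u (aeval T (n ^ 3 * n ^ 2) w) = 0 := (apply_cube_mul _).trans (hw 0)
  have h₁ : A u (aeval T (n ^ 3 * (n * m)) w) = 0 := (apply_cube_mul _).trans (hw 1)
  have h₂ : A u (aeval T (n ^ 3 * m ^ 2) w) = 1 := (apply_cube_mul _).trans (hw 2)
  have h₃ : A u (aeval T (n ^ 2 * m ^ 3) w) = 0 := by rw [apply_cube_mul', h₀, neg_zero]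
  have h₄ : A u (aeval T (n * m * m ^ 3) w) = 0 := by rw [apply_cube_mul', h₁, neg_zero]
  have h₅ : A u (aeval T (m ^ 2 * m ^ 3) w) = -1 := by rw [apply_cube_mul', h₂]
  rw [show n ^ 3 * n ^ 2 = n ^ 5 * m ^ 0 by ring] at h₀
  rw [show n ^ 3 * (n * m) = n ^ 4 * m ^ 1 by ring] at h₁
  rw [show n * m * m ^ 3 = n ^ 1 * m ^ 4 by ring] at h₄
  rw [show m ^ 2 * m ^ 3 = n ^ 0 * m ^ 5 by ring] at h₅
  refine ⟨w, fun k => ?_⟩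
  fin_cases k
  exacts [h₀, h₁, h₂, h₃, h₄, h₅]

end NormalForm

section Frame

variable {K V : Type*} [Field K] [AddCommGroup V] [Module K V] {A₁ A₂ : LinearMap.BilinForm K V}

/-- A parametrisation of a space with two bilinear forms that pulls them back to `dα₃` and `dα₅`.
It must kill `X₃` and `X₅`, which span the common radical of these two forms on `K ^ 8`. -/
structure IsK8Frame (A₁ A₂ : LinearMap.BilinForm K V) (f : Vec K 8 →ₗ[K] V) : Prop where
  map_X3 : f (Pi.single 2 1) = 0
  map_X5 : f (Pi.single 4 1) = 0
  dAlpha3_eq : ∀ x y, A₁ (f x) (f y) = dAlpha3 x y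
  dAlpha5_eq : ∀ x y, A₂ (f x) (f y) = dAlpha5 x y

/- The products in `dα₃` and `dα₅` are the edges of the hexagon `1 - 2 - 8 - 7 - 6 - 4 - 1`, those
of the two forms alternating; the `U i` and the `W i` are the two classes of its bipartition. -/
theorem isK8Frame_of_hexagon (hA₁ : A₁.IsAlt) (hA₂ : A₂.IsAlt) {U W : Fin 3 → V}
    (hU₁ : ∀ i j, A₁ (U i) (U j) = 0) (hW₁ : ∀ i j, A₁ (W i) (W j) = 0)
    (hU₂ : ∀ i j, A₂ (U i) (U j) = 0) (hW₂ : ∀ i j, A₂ (W i) (W j) = 0)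
    (hUW₁ : ∀ i j, A₁ (U i) (W j) = !![0, 0, 1; 0, 1, 0; 1, 0, 0] i j)
    (hUW₂ : ∀ i j, A₂ (U i) (W j) = !![0, 1, 0; 1, 0, 0; 0, 0, -1] i j) :
    IsK8Frame A₁ A₂ (Fintype.linearCombination K ![U 0, W 2, 0, W 1, 0, -U 1, -W 0, U 2]) where
  map_X3 := by simp [Fintype.linearCombination_apply_single]
  map_X5 := by simp [Fintype.linearCombination_apply_single]
  dAlpha3_eq x y := by
    have hWU₁ (i j) : A₁ (W i) (U j) = -A₁ (U j) (W i) := (hA₁.neg_eq _ _).symm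
    simp only [Fintype.linearCombination_apply, Fin.sum_univ_eight, Matrix.cons_val, smul_zero,
      add_zero, smul_neg, map_add, map_smul, map_neg, LinearMap.add_apply, LinearMap.smul_apply,
      LinearMap.neg_apply, smul_eq_mul, Matrix.of_apply, hU₁, hW₁, hWU₁, hUW₁, dAlpha3, wedge]
    ring
  dAlpha5_eq x y := by
    have hWU₂ (i j) : A₂ (W i) (U j) = -A₂ (U j) (W i) := (hA₂.neg_eq _ _).symm
    simp only [Fintype.linearCombination_apply, Fin.sum_univ_eight, Matrix.cons_val, smul_zero,
      add_zero, smul_neg, map_add, map_smul, map_neg, LinearMap.add_apply, LinearMap.smul_apply,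
      LinearMap.neg_apply, smul_eq_mul, Matrix.of_apply, hU₂, hW₂, hWU₂, hUW₂, dAlpha5, wedge]
    ring

theorem isAlt_compl₂ {R M : Type*} [CommRing R] [NoZeroDivisors R] [NeZero (2 : R)]
    [AddCommGroup M] [Module R M] {A : LinearMap.BilinForm R M} {T : Module.End R M}
    (hA : A.IsAlt) (hT : A.IsSelfAdjoint T) : LinearMap.BilinForm.IsAlt (A.compl₂ T) :=
  apply_apply_self_eq_zero hA hT

theorem exists_isK8Frame_of_cube_add_cube_eq_zero [NeZero (2 : K)] [FiniteDimensional K V]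
    {A : LinearMap.BilinForm K V} {T : Module.End K V} {u : V} {m n : K[X]} (hA : A.IsAlt)
    (hnd : A.Nondegenerate) (hT : A.IsSelfAdjoint T) (hmn : IsCoprime m n)
    (hcubes : aeval T (m ^ 3 + n ^ 3) = 0)
    (hu : LinearIndependent K ![aeval T (n ^ 2) u, aeval T (n * m) u, aeval T (m ^ 2) u]) :
    ∃ f, IsK8Frame (A.compl₂ (aeval T n)) (A.compl₂ (aeval T m)) f := by
  obtain ⟨w, hw⟩ := exists_krylov_dual_of_cube_add_cube_eq_zero hnd hT hmn hcubes hu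
  let p (i : Fin 3) : K[X] := n ^ (2 - i : ℕ) * m ^ (i : ℕ)
  have isotropic (q : K[X]) (x : V) (i j : Fin 3) :
      A.compl₂ (aeval T q) (aeval T (p i) x) (aeval T (p j) x) = 0 := by
    rw [LinearMap.compl₂_apply, ← Module.End.mul_apply, ← map_mul, apply_aeval_aeval_self hA hT]
  have apply_p_p (q : K[X]) (i j : Fin 3) :
      A.compl₂ (aeval T q) (aeval T (p i) u) (aeval T (p j) w) =
        A u (aeval T (n ^ (4 - (i + j) : ℕ) * m ^ (i + j : ℕ) * q) w) := by
    have p_mul_p : p i * (q * p j) = n ^ (4 - (i + j) : ℕ) * m ^ (i + j : ℕ) * q := by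
      rw [show (4 - (i + j) : ℕ) = (2 - i) + (2 - j) by omega]
      ring
    rw [LinearMap.compl₂_apply, ← Module.End.mul_apply, ← map_mul, apply_aeval_aeval hT, p_mul_p]
  refine ⟨_, isK8Frame_of_hexagon (isAlt_compl₂ hA (isAdjointPair_aeval hT n))
    (isAlt_compl₂ hA (isAdjointPair_aeval hT m)) (isotropic n u) (isotropic n w) (isotropic m u)
    (isotropic m w) (fun i j => ?_) (fun i j => ?_)⟩
  · rw [apply_p_p, mul_right_comm, ← pow_succ,
      show 4 - (i + j : ℕ) + 1 = 5 - (i + j : ℕ) by omega]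
    fin_cases i <;> fin_cases j
    exacts [hw 0, hw 1, hw 2, hw 1, hw 2, hw 3, hw 2, hw 3, hw 4]
  · rw [apply_p_p, mul_assoc, ← pow_succ,
      show 4 - (i + j : ℕ) = 5 - (i + j + 1 : ℕ) by omega]
    fin_cases i <;> fin_cases j
    exacts [hw 1, hw 2, hw 3, hw 2, hw 3, hw 4, hw 3, hw 4, hw 5]

end Frame

namespace TwoNilp

variable {K : Type*} [Field K]

theorem apply_swap {n : ℕ} (ν : TwoNilp K n) (x y : Vec K n) : ν.1 x y = -ν.1 y x :=
  (LinearMap.IsAlt.neg ν.2.1.alt y x).symm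

theorem apply_apply_left {n : ℕ} (ν : TwoNilp K n) (x y : Vec K n) : ν.1 (ν.1 x y) = 0 := by
  refine LinearMap.ext fun z => ?_
  rw [apply_swap, ν.2.2, neg_zero, LinearMap.zero_apply]

theorem mem_orbit_of_injective {n : ℕ} {μ ν : TwoNilp K n} {g : Vec K n →ₗ[K] Vec K n}
    (hg : Function.Injective g) (map_bracket : ∀ x y, g (μ.1 x y) = ν.1 (g x) (g y)) :
    ν ∈ μ.orbit := by
  refine ⟨LinearEquiv.ofInjectiveEndo g hg, fun x y => ?_⟩
  have apply_symm := (LinearEquiv.ofInjectiveEndo g hg).apply_symm_apply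
  rw [LinearEquiv.coe_ofInjectiveEndo, map_bracket, ← LinearEquiv.coe_ofInjectiveEndo g hg,
    apply_symm, apply_symm]

end TwoNilp

section Frame

variable {K : Type*} [Field K] {ν : TwoNilp K 8} {φ ψ : Vec K 8 →ₗ[K] K}
  {f : Vec K 8 →ₗ[K] Vec K 8} {z t : Vec K 8}

theorem eq_single_add_single_of_dAlpha3_eq_zero {x : Vec K 8} (h : ∀ y, dAlpha3 x y = 0) :
    x = x 2 • Pi.single 2 1 + x 4 • Pi.single 4 1 := by
  have h₀ : x 0 = 0 := by simpa [dAlpha3, wedge] using h (Pi.single 1 1)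
  have h₁ : x 1 = 0 := by simpa [dAlpha3, wedge] using h (Pi.single 0 1)
  have h₃ : x 3 = 0 := by simpa [dAlpha3, wedge] using h (Pi.single 5 1)
  have h₅ : x 5 = 0 := by simpa [dAlpha3, wedge] using h (Pi.single 3 1)
  have h₆ : x 6 = 0 := by simpa [dAlpha3, wedge] using h (Pi.single 7 1)
  have h₇ : x 7 = 0 := by simpa [dAlpha3, wedge] using h (Pi.single 6 1)
  ext i
  fin_cases i <;> simp [*]

/-- The extension of a frame `f` of `K ^ 8 / ⟨X₃, X₅⟩` to `K ^ 8` by `X₃ ↦ z`, `X₅ ↦ t`. -/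
def extendFrame (f : Vec K 8 →ₗ[K] Vec K 8) (z t : Vec K 8) : Vec K 8 →ₗ[K] Vec K 8 :=
  f + (LinearMap.proj 2).smulRight z + (LinearMap.proj 4).smulRight t

theorem extendFrame_apply (x : Vec K 8) : extendFrame f z t x = f x + x 2 • z + x 4 • t := rfl

theorem bracket_extendFrame (hz : ν.1 z = 0) (ht : ν.1 t = 0) (x y : Vec K 8) :
    ν.1 (extendFrame f z t x) (extendFrame f z t y) = ν.1 (f x) (f y) := by
  simp [extendFrame_apply, ν.apply_swap (f x) z, ν.apply_swap (f x) t, hz, ht]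

theorem extendFrame_k8Bracket (hf : IsK8Frame (ν.1.compr₂ φ) (ν.1.compr₂ ψ) f) (x y : Vec K 8) :
    extendFrame f z t (k8Bracket K x y) = -dAlpha3 x y • z - dAlpha5 x y • t := by
  rw [k8Bracket_apply, map_sub, map_smul, map_smul, extendFrame_apply, extendFrame_apply,
    hf.map_X3, hf.map_X5]
  simp

theorem injective_extendFrame (hf : IsK8Frame (ν.1.compr₂ φ) (ν.1.compr₂ ψ) f)
    (hz : ν.1 z = 0) (ht : ν.1 t = 0) (hφz : φ z = -1) (hφt : φ t = 0) (hψz : ψ z = 0)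
    (hψt : ψ t = -1) : Function.Injective (extendFrame f z t) := by
  refine (injective_iff_map_eq_zero _).2 fun x hx => ?_
  have dAlpha3_eq_zero (y : Vec K 8) : dAlpha3 x y = 0 := by
    rw [← hf.dAlpha3_eq, LinearMap.compr₂_apply, ← bracket_extendFrame hz ht, hx, map_zero,
      LinearMap.zero_apply, map_zero]
  have eq_singles := eq_single_add_single_of_dAlpha3_eq_zero dAlpha3_eq_zero
  have map_x : f x = 0 := by
    rw [eq_singles, map_add, map_smul, map_smul, hf.map_X3, hf.map_X5, smul_zero, smul_zero,
      add_zero]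
  rw [extendFrame_apply, map_x, zero_add] at hx
  have h₂ : x 2 = 0 := by simpa [hφz, hφt] using congrArg φ hx
  have h₄ : x 4 = 0 := by simpa [hψz, hψt] using congrArg ψ hx
  rw [eq_singles, h₂, h₄, zero_smul, zero_smul, add_zero]

theorem TwoNilp.mem_orbit_k8_of_isK8Frame (hf : IsK8Frame (ν.1.compr₂ φ) (ν.1.compr₂ ψ) f)
    (hinj : ∀ z, ν.1 z = 0 → φ z = 0 → ψ z = 0 → z = 0) : ν ∈ (k8 K).orbit := by
  have map_bracket₃ (x y) : φ (ν.1 (f x) (f y)) = dAlpha3 x y := hf.dAlpha3_eq x y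
  have map_bracket₅ (x y) : ψ (ν.1 (f x) (f y)) = dAlpha5 x y := hf.dAlpha5_eq x y
  let z := -ν.1 (f (Pi.single 0 1)) (f (Pi.single 1 1))
  let t := -ν.1 (f (Pi.single 0 1)) (f (Pi.single 3 1))
  have hz : ν.1 z = 0 := by rw [map_neg, apply_apply_left, neg_zero]
  have ht : ν.1 t = 0 := by rw [map_neg, apply_apply_left, neg_zero]
  have hφz : φ z = -1 := by simp [z, map_bracket₃, dAlpha3, wedge]
  have hφt : φ t = 0 := by simp [t, map_bracket₃, dAlpha3, wedge]
  have hψz : ψ z = 0 := by simp [z, map_bracket₅, dAlpha5, wedge]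
  have hψt : ψ t = -1 := by simp [t, map_bracket₅, dAlpha5, wedge]
  refine mem_orbit_of_injective (injective_extendFrame hf hz ht hφz hφt hψz hψt) fun x y => ?_
  change extendFrame f z t (k8Bracket K x y) = _
  rw [extendFrame_k8Bracket hf, bracket_extendFrame hz ht, ← sub_eq_zero]
  refine hinj _ ?_ ?_ ?_
  · simp [apply_apply_left, hz, ht]
  · simp [map_bracket₃, hφz, hφt]
  · simp [map_bracket₅, hψz, hψt]

end Frame

section Pencil

variable {K V : Type*} [Field K] [AddCommGroup V] [Module K V] {A : LinearMap.BilinForm K V}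
  {T : Module.End K V} {u w : V}

theorem exists_isK8Frame_of_discr_eq_sq [NeZero (2 : K)] [NeZero (3 : K)]
    (hcube : Function.Surjective fun x : K => x ^ 3) (hA : A.IsAlt) (hnd : A.Nondegenerate)
    (hT : A.IsSelfAdjoint T) (hdim : Module.finrank K V = 6)
    (hdet : (hankel (fun k => A u ((T ^ k) w)) 3).det ≠ 0) {s : K} (hs : s ≠ 0)
    (hdiscr : -3 * (recurrenceCubic fun k => A u ((T ^ k) w)).discr = s ^ 2) :
    ∃ m₁ m₀ n₁ n₀ : K, m₁ * n₀ - m₀ * n₁ ≠ 0 ∧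
      ∃ f, IsK8Frame (A.compl₂ (aeval T (C n₁ * X + C n₀)))
        (A.compl₂ (aeval T (C m₁ * X + C m₀))) f := by
  have : FiniteDimensional K V := Module.finite_of_finrank_pos (by omega)
  obtain ⟨m₁, m₀, n₁, n₀, hmn, hcubes⟩ :=
    exists_toPoly_eq_cube_add_cube hcube _ hdet hs hdiscr
  have aeval_cubes := aeval_recurrenceCubic_eq_zero hA hnd hT hdim hdet
  rw [hcubes] at aeval_cubes
  have hu := (linearIndependent_krylov_pair hA hT hdet).comp _ Sum.inl_injective
  exact ⟨m₁, m₀, n₁, n₀, hmn, exists_isK8Frame_of_cube_add_cube_eq_zero hA hnd hT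
    (isCoprime_linear hmn) aeval_cubes (linearIndependent_quadratics hu hmn)⟩

theorem compl₂_aeval_linear {B : LinearMap.BilinForm K V} {d : K}
    (h : ∀ x y, A x (T y) = d * B x y) (a b : K) :
    A.compl₂ (aeval T (C a * X + C b)) = (a * d) • B + b • A := by
  ext x y
  simp [h, mul_assoc]

theorem IsK8Frame.comp {W : Type*} [AddCommGroup W] [Module K W] {A₁ A₂ : LinearMap.BilinForm K W}
    {g : V →ₗ[K] W} {f : Vec K 8 →ₗ[K] V}
    (hf : IsK8Frame (A₁.compl₁₂ g g) (A₂.compl₁₂ g g) f) : IsK8Frame A₁ A₂ (g ∘ₗ f) where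
  map_X3 := by rw [LinearMap.comp_apply, hf.map_X3, map_zero]
  map_X5 := by rw [LinearMap.comp_apply, hf.map_X5, map_zero]
  dAlpha3_eq := hf.dAlpha3_eq
  dAlpha5_eq := hf.dAlpha5_eq

end Pencil

section Invariants

variable {R S : Type*} [CommRing R] [CommRing S]

/-- The coordinates of `K ^ 8` other than `X₃` and `X₅`, in 0-based indexing. -/
def symIdx : Fin 6 → Fin 8 := ![0, 1, 3, 5, 6, 7]

/-- The matrix of the `X_{k+1}`-component of the bracket with structure constants `c`, restricted
to the span of the basis vectors `symIdx`. -/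
def formMat (c : StrIndex 8 → R) (k : Fin 8) : Matrix (Fin 6) (Fin 6) R :=
  Matrix.of fun i j => c (symIdx i, symIdx j, k)

/-- The operator relating the two forms of the pencil, multiplied by the determinant of the first
form so that its entries are polynomials in the structure constants. -/
def opMat (c : StrIndex 8 → R) : Matrix (Fin 6) (Fin 6) R :=
  (formMat c 2).adjugate * formMat c 4

/-- The moments `A e (T ^ n e')` of the operator `opMat`, with `A` the first form of the pencil. -/
def moment (c : StrIndex 8 → R) (n : ℕ) : R :=
  (formMat c 2 * opMat c ^ n) 0 4

/-- The cubic which annihilates `opMat` when the pencil is regular. -/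
def pencilCubic (c : StrIndex 8 → R) : Cubic R :=
  recurrenceCubic (moment c)

/-- The polynomial in the structure constants whose non-vanishing makes the first form of the
pencil nondegenerate, with a Krylov basis for `opMat`. -/
def regularity (c : StrIndex 8 → R) : R :=
  (formMat c 2).det * (hankel (moment c) 3).det

/-- The discriminant of the Hessian of `pencilCubic`, up to a square factor. -/
def hessianDiscr (c : StrIndex 8 → R) : R :=
  -3 * (pencilCubic c).discr

theorem comp_moment (f : R →+* S) (c : StrIndex 8 → R) : f ∘ moment c = moment (f ∘ c) := by
  have map_formMat (k : Fin 8) : f.mapMatrix (formMat c k) = formMat (f ∘ c) k := rfl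
  have map_opMat : f.mapMatrix (opMat c) = opMat (f ∘ c) := by
    rw [opMat, map_mul, f.map_adjugate, map_formMat, map_formMat, opMat]
  funext n
  have map_mul_pow : f.mapMatrix (formMat c 2 * opMat c ^ n) =
      formMat (f ∘ c) 2 * opMat (f ∘ c) ^ n := by
    rw [map_mul, map_pow, map_formMat, map_opMat]
  exact congrFun (congrFun map_mul_pow 0) 4

theorem map_regularity (f : R →+* S) (c : StrIndex 8 → R) :
    f (regularity c) = regularity (f ∘ c) := by
  rw [regularity, map_mul, f.map_det, f.map_det, RingHom.mapMatrix_apply, RingHom.mapMatrix_apply,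
    map_hankel, comp_moment]
  rfl

theorem map_pencilCubic (f : R →+* S) (c : StrIndex 8 → R) :
    (pencilCubic c).map f = pencilCubic (f ∘ c) := by
  rw [pencilCubic, map_recurrenceCubic, comp_moment, pencilCubic]

theorem map_hessianDiscr (f : R →+* S) (c : StrIndex 8 → R) :
    f (hessianDiscr c) = hessianDiscr (f ∘ c) := by
  rw [hessianDiscr, hessianDiscr, ← map_pencilCubic]
  simp only [Cubic.discr, Cubic.map, map_add, map_sub, map_mul, map_neg, map_pow, map_ofNat]

end Invariants

section Values

variable {K : Type*} [Field K]

theorem formMat_k8_two : formMat (strConst (k8 K).1) 2 =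
    !![0, -1, 0, 0, 0, 0; 1, 0, 0, 0, 0, 0; 0, 0, 0, -1, 0, 0; 0, 0, 1, 0, 0, 0;
      0, 0, 0, 0, 0, -1; 0, 0, 0, 0, 1, 0] := by
  ext i j
  fin_cases i <;> fin_cases j <;>
    simp [formMat, strConst, k8, k8Bracket_apply, symIdx, dAlpha3, dAlpha5, wedge,
      Pi.single_apply]

theorem formMat_k8_four : formMat (strConst (k8 K).1) 4 =
    !![0, 0, -1, 0, 0, 0; 0, 0, 0, 0, 0, -1; 1, 0, 0, 0, 0, 0; 0, 0, 0, 0, -1, 0;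
      0, 0, 0, 1, 0, 0; 0, 1, 0, 0, 0, 0] := by
  ext i j
  fin_cases i <;> fin_cases j <;>
    simp [formMat, strConst, k8, k8Bracket_apply, symIdx, dAlpha3, dAlpha5, wedge,
      Pi.single_apply]

theorem det_formMat_k8_two : (formMat (strConst (k8 K).1) 2).det = 1 := by
  rw [formMat_k8_two]
  simp [Matrix.det_succ_row_zero, Fin.sum_univ_succ, Fin.succAbove]

theorem opMat_k8 : opMat (strConst (k8 K).1) =
    !![0, 0, 0, 0, 0, -1; 0, 0, 1, 0, 0, 0; 0, 0, 0, 0, -1, 0;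
      -1, 0, 0, 0, 0, 0; 0, 1, 0, 0, 0, 0; 0, 0, 0, -1, 0, 0] := by
  have mul_opMat : formMat (strConst (k8 K).1) 2 * opMat (strConst (k8 K).1) =
      formMat (strConst (k8 K).1) 4 := by
    rw [opMat, ← mul_assoc, Matrix.mul_adjugate, det_formMat_k8_two, one_smul, one_mul]
  have mul_self : formMat (strConst (k8 K).1) 2 * formMat (strConst (k8 K).1) 2 = -1 := by
    rw [formMat_k8_two]
    ext i j
    fin_cases i <;> fin_cases j <;> simp [Matrix.mul_apply, Fin.sum_univ_six]
  rw [← neg_neg (opMat _), ← neg_one_mul (opMat _), ← mul_self, mul_assoc, mul_opMat,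
    formMat_k8_two, formMat_k8_four]
  ext i j
  fin_cases i <;> fin_cases j <;> simp

theorem opMat_k8_sq : opMat (strConst (k8 K).1) ^ 2 =
    !![0, 0, 0, 1, 0, 0; 0, 0, 0, 0, -1, 0; 0, -1, 0, 0, 0, 0;
      0, 0, 0, 0, 0, 1; 0, 0, 1, 0, 0, 0; 1, 0, 0, 0, 0, 0] := by
  rw [pow_two, opMat_k8]
  ext i j
  fin_cases i <;> fin_cases j <;> simp [Matrix.mul_apply, Fin.sum_univ_six]

theorem opMat_k8_cube : opMat (strConst (k8 K).1) ^ 3 = -1 := by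
  rw [pow_succ, opMat_k8_sq, opMat_k8]
  ext i j
  fin_cases i <;> fin_cases j <;> simp [Matrix.mul_apply, Fin.sum_univ_six]

theorem moment_k8 (k : Fin 6) :
    moment (strConst (k8 K).1) k = (![0, 0, 1, 0, 0, -1] : Fin 6 → K) k := by
  have moment_add_three (n : ℕ) :
      moment (strConst (k8 K).1) (n + 3) = -moment (strConst (k8 K).1) n := by
    rw [moment, pow_add, opMat_k8_cube, mul_neg, mul_one, mul_neg, Matrix.neg_apply, moment]
  have h₀ : moment (strConst (k8 K).1) 0 = 0 := by simp [moment, formMat_k8_two]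
  have h₁ : moment (strConst (k8 K).1) 1 = 0 := by
    simp [moment, formMat_k8_two, opMat_k8, Matrix.mul_apply, Fin.sum_univ_six]
  have h₂ : moment (strConst (k8 K).1) 2 = 1 := by
    simp [moment, formMat_k8_two, opMat_k8_sq, Matrix.mul_apply, Fin.sum_univ_six]
  fin_cases k
  exacts [h₀, h₁, h₂, by simpa [h₀] using moment_add_three 0,
    by simpa [h₁] using moment_add_three 1, by simpa [h₂] using moment_add_three 2]

theorem hankel_moment_k8 :
    hankel (moment (strConst (k8 K).1)) 3 = !![0, 0, 1; 0, 1, 0; 1, 0, 0] := by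
  ext i j
  fin_cases i <;> fin_cases j
  exacts [moment_k8 0, moment_k8 1, moment_k8 2, moment_k8 1, moment_k8 2, moment_k8 3,
    moment_k8 2, moment_k8 3, moment_k8 4]

theorem pencilCubic_k8 : pencilCubic (strConst (k8 K).1) = ⟨-1, 0, 0, -1⟩ := by
  have shifted_moments :
      (fun i : Fin 3 => moment (strConst (k8 K).1) (i + 3)) = ![0, 0, -1] := by
    ext i
    fin_cases i
    exacts [moment_k8 3, moment_k8 4, moment_k8 5]
  ext <;> simp [pencilCubic, recurrenceCubic, hankel_moment_k8, shifted_moments,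
    Matrix.cramer_apply, Matrix.det_fin_three]

theorem regularity_k8_ne_zero : regularity (strConst (k8 K).1) ≠ 0 := by
  simp [regularity, det_formMat_k8_two, hankel_moment_k8, Matrix.det_fin_three]

theorem hessianDiscr_k8 : hessianDiscr (strConst (k8 K).1) = 9 ^ 2 := by
  rw [hessianDiscr, pencilCubic_k8, Cubic.discr]
  norm_num

theorem hessianDiscr_k8_ne_zero [NeZero (3 : K)] : hessianDiscr (strConst (k8 K).1) ≠ 0 := by
  rw [hessianDiscr_k8, show (9 : K) ^ 2 = 3 ^ 4 by norm_num]
  exact pow_ne_zero 4 three_ne_zero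

end Values

section Criterion

theorem toBilin'_apply_toLin' {R ι : Type*} [CommRing R] [Fintype ι] [DecidableEq ι]
    (M N : Matrix ι ι R) (x y : ι → R) :
    Matrix.toBilin' M x (Matrix.toLin' N y) = Matrix.toBilin' (M * N) x y := by
  rw [Matrix.toBilin'_apply', Matrix.toBilin'_apply', Matrix.toLin'_apply, Matrix.mulVec_mulVec]

theorem apply_opMat {R : Type*} [CommRing R] (c : StrIndex 8 → R) (x y : Fin 6 → R) :
    Matrix.toBilin' (formMat c 2) x (Matrix.toLin' (opMat c) y) =
      (formMat c 2).det * Matrix.toBilin' (formMat c 4) x y := by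
  rw [toBilin'_apply_toLin', opMat, ← mul_assoc, Matrix.mul_adjugate, smul_mul_assoc, one_mul,
    map_smul]
  rfl

theorem apply_opMat_pow {R : Type*} [CommRing R] (c : StrIndex 8 → R) (n : ℕ) :
    Matrix.toBilin' (formMat c 2) (Pi.single 0 1)
      ((Matrix.toLin' (opMat c) ^ n) (Pi.single 4 1)) = moment c n := by
  rw [← Matrix.toLin'_pow, toBilin'_apply_toLin', Matrix.toBilin'_single, moment]

/-- The inclusion of the span of the basis vectors `symIdx`. -/
def symInclusion (K : Type*) [Field K] : (Fin 6 → K) →ₗ[K] Vec K 8 :=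
  Fintype.linearCombination K fun i => Pi.single (symIdx i) 1

variable {K : Type*} [Field K]

theorem symInclusion_comp_symIdx {z : Vec K 8} (h₂ : z 2 = 0) (h₄ : z 4 = 0) :
    symInclusion K (z ∘ symIdx) = z := by
  ext i
  fin_cases i <;>
    simp [symInclusion, Fintype.linearCombination_apply, Fin.sum_univ_six, symIdx, h₂, h₄]

theorem toBilin'_formMat (μ : BilinProduct K 8) (k : Fin 8) :
    Matrix.toBilin' (formMat (strConst μ) k) =
      (μ.compl₁₂ (symInclusion K) (symInclusion K)).compr₂ (LinearMap.proj k) := by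
  refine LinearMap.ext_basis (Pi.basisFun K _) (Pi.basisFun K _) fun i j => ?_
  simp only [Pi.basisFun_apply, Matrix.toBilin'_single, LinearMap.compr₂_apply,
    LinearMap.compl₁₂_apply, symInclusion, Fintype.linearCombination_apply_single, one_smul]
  rfl

namespace TwoNilp

variable {ν : TwoNilp K 8}

theorem isAlt_formMat (ν : TwoNilp K 8) (k : Fin 8) :
    (Matrix.toBilin' (formMat (strConst ν.1) k)).IsAlt := fun x => by
  rw [toBilin'_formMat, LinearMap.compr₂_apply, LinearMap.compl₁₂_apply, ν.2.1.alt, map_zero]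

theorem eq_zero_of_central (hnd : (formMat (strConst ν.1) 2).det ≠ 0) {z : Vec K 8}
    (hz : ν.1 z = 0) (h₂ : z 2 = 0) (h₄ : z 4 = 0) : z = 0 := by
  have comp_symIdx_eq_zero : z ∘ symIdx = 0 :=
    (LinearMap.BilinForm.nondegenerate_toBilin'_of_det_ne_zero' _ hnd).1 _ fun y => by
      rw [toBilin'_formMat, LinearMap.compr₂_apply, LinearMap.compl₁₂_apply,
        symInclusion_comp_symIdx h₂ h₄, hz, LinearMap.zero_apply, map_zero]
  rw [← symInclusion_comp_symIdx h₂ h₄, comp_symIdx_eq_zero, map_zero]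

theorem mem_orbit_k8 [NeZero (2 : K)] [NeZero (3 : K)]
    (hcube : Function.Surjective fun x : K => x ^ 3) (hreg : regularity (strConst ν.1) ≠ 0)
    (hdiscr : hessianDiscr (strConst ν.1) ≠ 0) (hsq : IsSquare (hessianDiscr (strConst ν.1))) :
    ν ∈ (k8 K).orbit := by
  set c := strConst ν.1
  obtain ⟨s, hs⟩ := isSquare_iff_exists_sq _ |>.1 hsq
  have hs₀ : s ≠ 0 := by
    rintro rfl
    exact hdiscr (by rw [hs, zero_pow two_ne_zero])
  obtain ⟨hδ, hhankel⟩ := mul_ne_zero_iff.1 hreg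
  set δ := (formMat c 2).det
  obtain ⟨m₁, m₀, n₁, n₀, hmn, f, hf⟩ := exists_isK8Frame_of_discr_eq_sq hcube
    (isAlt_formMat ν 2) (LinearMap.BilinForm.nondegenerate_toBilin'_of_det_ne_zero' _ hδ)
    (isSelfAdjoint_of_apply_eq_mul (isAlt_formMat ν 2) (isAlt_formMat ν 4) (apply_opMat c))
    (u := Pi.single 0 1) (w := Pi.single 4 1) (by simp)
    (by rwa [funext (apply_opMat_pow c)]) hs₀ (by rwa [funext (apply_opMat_pow c)])
  let p (a b : K) : Vec K 8 →ₗ[K] K := (a * δ) • LinearMap.proj 4 + b • LinearMap.proj 2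
  have pencil_eq (a b : K) : (Matrix.toBilin' (formMat c 2)).compl₂
      (aeval (Matrix.toLin' (opMat c)) (C a * X + C b)) =
        (ν.1.compr₂ (p a b)).compl₁₂ (symInclusion K) (symInclusion K) := by
    rw [compl₂_aeval_linear (apply_opMat c), toBilin'_formMat, toBilin'_formMat]
    rfl
  rw [pencil_eq, pencil_eq] at hf
  refine mem_orbit_k8_of_isK8Frame hf.comp fun z hz hn hm => ?_
  have hn : n₁ * δ * z 4 + n₀ * z 2 = 0 := hn
  have hm : m₁ * δ * z 4 + m₀ * z 2 = 0 := hm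
  have h₂ : z 2 = 0 := (mul_eq_zero.1 (by linear_combination m₁ * hn - n₁ * hm :
    (m₁ * n₀ - m₀ * n₁) * z 2 = 0)).resolve_left hmn
  have h₄ : z 4 = 0 := (mul_eq_zero.1 (by linear_combination n₀ * hm - m₀ * hn :
    (m₁ * n₀ - m₀ * n₁) * δ * z 4 = 0)).resolve_left (mul_ne_zero hmn hδ)
  exact eq_zero_of_central hδ hz h₂ h₄

end TwoNilp

end Criterion

section Zariski

variable {K σ τ : Type*} [Field K]

theorem isClosed_zariskiAffine_iff {Z : Set (σ → K)} :
    IsClosed[zariskiAffine σ K] Z ↔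
      ∃ S : Set (MvPolynomial σ K), Z = {x | ∀ p ∈ S, MvPolynomial.eval x p = 0} := by
  rw [← @isOpen_compl_iff _ _ (zariskiAffine σ K)]
  change Zᶜᶜ ∈ _ ↔ _
  rw [compl_compl]
  rfl

theorem isOpen_zariskiAffine_ne_zero (p : MvPolynomial σ K) :
    IsOpen[zariskiAffine σ K] {x | MvPolynomial.eval x p ≠ 0} := by
  rw [← @isClosed_compl_iff _ (zariskiAffine σ K)]
  exact isClosed_zariskiAffine_iff.2 ⟨{p}, by ext x; simp⟩

theorem continuous_zariskiAffine (P : τ → MvPolynomial σ K) :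
    @Continuous _ _ (zariskiAffine σ K) (zariskiAffine τ K)
      fun x t => MvPolynomial.eval x (P t) := by
  let := zariskiAffine σ K
  let := zariskiAffine τ K
  refine continuous_iff_isClosed.2 fun Z hZ => ?_
  obtain ⟨S, rfl⟩ := isClosed_zariskiAffine_iff.1 hZ
  refine isClosed_zariskiAffine_iff.2 ⟨MvPolynomial.bind₁ P '' S, ?_⟩
  ext x
  simp only [Set.mem_preimage, Set.mem_ofPred_eq, Set.forall_mem_image, MvPolynomial.eval,
    MvPolynomial.eval₂Hom_bind₁]

end Zariski

namespace TwoNilp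

variable {K : Type*} [Field K] {n : ℕ}

/-- The action of `GL(K^n)` on `2Nilp_n`, whose orbits are `TwoNilp.orbit`. -/
def act (g : Vec K n ≃ₗ[K] Vec K n) (ν : TwoNilp K n) : TwoNilp K n where
  val := (ν.1.compl₁₂ g.symm.toLinearMap g.symm.toLinearMap).compr₂ g.toLinearMap
  property := by
    refine ⟨⟨fun x => ?_, fun x y z => ?_⟩, fun x y z => ?_⟩
    · simp [ν.2.1.alt]
    · simp [← map_add, ν.2.1.jacobi]
    · simp [ν.2.2]

theorem act_apply (g : Vec K n ≃ₗ[K] Vec K n) (ν : TwoNilp K n) (x y : Vec K n) :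
    (act g ν).1 x y = g (ν.1 (g.symm x) (g.symm y)) := rfl

theorem mem_orbit_iff {μ ν : TwoNilp K n} : ν ∈ μ.orbit ↔ ∃ g, act g μ = ν := by
  refine exists_congr fun g => ⟨fun h => ?_, ?_⟩
  · exact Subtype.ext (LinearMap.ext₂ fun x y => (h x y).symm)
  · rintro rfl
    exact fun _ _ => rfl

theorem act_act (g h : Vec K n ≃ₗ[K] Vec K n) (ν : TwoNilp K n) :
    act g (act h ν) = act (h.trans g) ν := rfl

theorem act_symm_act (g : Vec K n ≃ₗ[K] Vec K n) (ν : TwoNilp K n) : act g.symm (act g ν) = ν :=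
  Subtype.ext (LinearMap.ext₂ fun x y => by simp [act_apply])

theorem act_act_symm (g : Vec K n ≃ₗ[K] Vec K n) (ν : TwoNilp K n) : act g (act g.symm ν) = ν :=
  act_symm_act g.symm ν

theorem isOpen_orbit_of_mem_nhds [TopologicalSpace (TwoNilp K n)]
    (hact : ∀ g, Continuous (act (K := K) (n := n) g)) {μ : TwoNilp K n} (hμ : μ.orbit ∈ 𝓝 μ) :
    IsOpen μ.orbit := by
  refine isOpen_iff_mem_nhds.2 fun ν hν => ?_
  obtain ⟨g, rfl⟩ := mem_orbit_iff.1 hν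
  have preimage_mem := (hact g.symm).continuousAt.preimage_mem_nhds
    (x := act g μ) (by rwa [act_symm_act])
  filter_upwards [preimage_mem] with ν hν
  obtain ⟨h, hh⟩ := mem_orbit_iff.1 hν
  exact mem_orbit_iff.2 ⟨h.trans g, by rw [← act_act, hh, act_act_symm]⟩

/-- The structure constants of `act g ν` as polynomials in those of `ν`. -/
noncomputable def actPoly (g : Vec K n ≃ₗ[K] Vec K n) (t : StrIndex n) :
    MvPolynomial (StrIndex n) K :=
  ∑ i, ∑ j, ∑ k, MvPolynomial.C (g.symm (Pi.single t.1 1) i * g.symm (Pi.single t.2.1 1) j *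
    g (Pi.single k 1) t.2.2) * MvPolynomial.X (i, j, k)

theorem strConst_act (g : Vec K n ≃ₗ[K] Vec K n) (ν : TwoNilp K n) :
    strConst (act g ν).1 = fun t => MvPolynomial.eval (strConst ν.1) (actPoly g t) := by
  funext t
  have expand (x : Vec K n) : x = ∑ i, x i • Pi.single i 1 := pi_eq_sum_univ' x
  have expand_bracket (i j : Fin n) : g (ν.1 (Pi.single i 1) (Pi.single j 1)) =
      ∑ k, strConst ν.1 (i, j, k) • g (Pi.single k 1) := by
    conv_lhs => rw [expand (ν.1 _ _), map_sum]
    simp only [map_smul, strConst]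
  rw [strConst, act_apply, expand (g.symm (Pi.single t.1 1)), expand (g.symm (Pi.single t.2.1 1))]
  simp only [map_sum, map_smul, LinearMap.sum_apply, LinearMap.smul_apply, Finset.sum_apply,
    Pi.smul_apply, smul_eq_mul, expand_bracket, actPoly, Finset.mul_sum, map_mul,
    MvPolynomial.eval_C, MvPolynomial.eval_X]
  rw [Finset.sum_comm]
  refine Finset.sum_congr rfl fun i _ => Finset.sum_congr rfl fun j _ =>
    Finset.sum_congr rfl fun k _ => ?_
  ring

theorem continuous_act_zariski (g : Vec K n ≃ₗ[K] Vec K n) :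
    @Continuous _ _ (zariski K n) (zariski K n) (act g) := by
  let := zariskiAffine (StrIndex n) K
  let := zariski K n
  refine continuous_induced_rng.2 ?_
  simp only [Function.comp_def, strConst_act]
  exact (continuous_zariskiAffine (actPoly g)).comp continuous_induced_dom

theorem eventually_zariski_ne_zero {p : MvPolynomial (StrIndex n) K} {μ : TwoNilp K n}
    (hp : MvPolynomial.eval (strConst μ.1) p ≠ 0) :
    ∀ᶠ ν in @nhds _ (zariski K n) μ, MvPolynomial.eval (strConst ν.1) p ≠ 0 := by
  let := zariskiAffine (StrIndex n) K
  let := zariski K n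
  exact ((isOpen_zariskiAffine_ne_zero p).preimage continuous_induced_dom).mem_nhds hp

theorem continuous_classical_eval [TopologicalSpace K] [IsTopologicalSemiring K]
    (p : MvPolynomial (StrIndex n) K) :
    @Continuous _ _ (classical K n) _ fun ν => MvPolynomial.eval (strConst ν.1) p := by
  let := classical K n
  exact (MvPolynomial.continuous_eval p).comp continuous_induced_dom

theorem continuous_act_classical [TopologicalSpace K] [IsTopologicalSemiring K]
    (g : Vec K n ≃ₗ[K] Vec K n) : @Continuous _ _ (classical K n) (classical K n) (act g) := by
  let := classical K n
  refine continuous_induced_rng.2 ?_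
  simp only [Function.comp_def, strConst_act]
  exact continuous_pi fun t => continuous_classical_eval (actPoly g t)

end TwoNilp

section Rigidity

theorem eval_generic_regularity {R : Type*} [CommRing R] (x : StrIndex 8 → R) :
    MvPolynomial.eval x (regularity MvPolynomial.X) = regularity x := by
  rw [map_regularity]
  exact congrArg _ (funext (MvPolynomial.eval_X (f := x)))

theorem eval_generic_hessianDiscr {R : Type*} [CommRing R] (x : StrIndex 8 → R) :
    MvPolynomial.eval x (hessianDiscr MvPolynomial.X) = hessianDiscr x := by
  rw [map_hessianDiscr]
  exact congrArg _ (funext (MvPolynomial.eval_X (f := x)))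

variable {K : Type*} [Field K] [NeZero (2 : K)] [NeZero (3 : K)]

theorem isOpen_zariski_orbit_k8 (hcube : Function.Surjective fun x : K => x ^ 3)
    (hsq : ∀ x : K, IsSquare x) : IsOpen[TwoNilp.zariski K 8] (k8 K).orbit := by
  let := TwoNilp.zariski K 8
  refine TwoNilp.isOpen_orbit_of_mem_nhds TwoNilp.continuous_act_zariski ?_
  have regularity_ne_zero : ∀ᶠ ν in 𝓝 (k8 K), regularity (strConst ν.1) ≠ 0 := by
    simpa only [eval_generic_regularity] using TwoNilp.eventually_zariski_ne_zero
      (p := regularity MvPolynomial.X)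
      (by rw [eval_generic_regularity]; exact regularity_k8_ne_zero)
  have hessianDiscr_ne_zero : ∀ᶠ ν in 𝓝 (k8 K), hessianDiscr (strConst ν.1) ≠ 0 := by
    simpa only [eval_generic_hessianDiscr] using TwoNilp.eventually_zariski_ne_zero
      (p := hessianDiscr MvPolynomial.X)
      (by rw [eval_generic_hessianDiscr]; exact hessianDiscr_k8_ne_zero)
  filter_upwards [regularity_ne_zero, hessianDiscr_ne_zero] with ν hreg hdiscr
  exact TwoNilp.mem_orbit_k8 hcube hreg hdiscr (hsq _)

theorem isOpen_classical_orbit_k8 [TopologicalSpace K] [IsTopologicalSemiring K] [T1Space K]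
    (hcube : Function.Surjective fun x : K => x ^ 3) (hsq : {x : K | IsSquare x} ∈ 𝓝 1) :
    IsOpen[TwoNilp.classical K 8] (k8 K).orbit := by
  let := TwoNilp.classical K 8
  refine TwoNilp.isOpen_orbit_of_mem_nhds TwoNilp.continuous_act_classical ?_
  have continuous_regularity : Continuous fun ν : TwoNilp K 8 => regularity (strConst ν.1) := by
    simpa only [eval_generic_regularity] using
      TwoNilp.continuous_classical_eval (regularity (MvPolynomial.X (R := K)))
  have continuous_hessianDiscr : Continuous fun ν : TwoNilp K 8 => hessianDiscr (strConst ν.1) := by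
    simpa only [eval_generic_hessianDiscr] using
      TwoNilp.continuous_classical_eval (hessianDiscr (MvPolynomial.X (R := K)))
  have nine_sq_ne_zero : (9 : K) ^ 2 ≠ 0 := hessianDiscr_k8 (K := K) ▸ hessianDiscr_k8_ne_zero
  have tendsto_one : Filter.Tendsto (fun ν : TwoNilp K 8 => hessianDiscr (strConst ν.1) / 9 ^ 2)
      (𝓝 (k8 K)) (𝓝 1) :=
    (continuous_hessianDiscr.div_const _).tendsto' _ _ (by
      rw [hessianDiscr_k8, div_self nine_sq_ne_zero])
  filter_upwards [continuous_regularity.continuousAt.eventually_ne regularity_k8_ne_zero,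
    continuous_hessianDiscr.continuousAt.eventually_ne hessianDiscr_k8_ne_zero, tendsto_one hsq]
    with ν hreg hdiscr hdiv
  refine TwoNilp.mem_orbit_k8 hcube hreg hdiscr ?_
  rw [← div_mul_cancel₀ (hessianDiscr (strConst ν.1)) nine_sq_ne_zero]
  exact hdiv.mul (IsSquare.sq 9)

end Rigidity

theorem surjective_pow_three_real : Function.Surjective fun x : ℝ => x ^ 3 := by
  intro x
  rcases le_total 0 x with hx | hx
  · exact ⟨_, Real.rpow_inv_natCast_pow hx three_ne_zero⟩
  · obtain ⟨y, hy⟩ : ∃ y : ℝ, y ^ 3 = -x :=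
      ⟨_, Real.rpow_inv_natCast_pow (neg_nonneg.2 hx) three_ne_zero⟩
    exact ⟨-y, by simp [Odd.neg_pow (by decide : Odd 3), hy]⟩

theorem isSquare_mem_nhds_one_real : {x : ℝ | IsSquare x} ∈ 𝓝 1 :=
  Filter.mem_of_superset (Ioi_mem_nhds one_pos) fun _ hx => Real.isSquare_iff.2 hx.le

theorem mainTheorem7_general {K : Type*} [Field K] [NeZero (2 : K)] [NeZero (3 : K)]
    (hcube : Function.Surjective fun x : K => x ^ 3) :
    ((∀ x : K, IsSquare x) → IsOpen[TwoNilp.zariski K 8] (k8 K).orbit) ∧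
    ∀ [TopologicalSpace K] [IsTopologicalSemiring K] [T1Space K],
      {x : K | IsSquare x} ∈ 𝓝 1 → IsOpen[TwoNilp.classical K 8] (k8 K).orbit :=
  ⟨isOpen_zariski_orbit_k8 hcube, isOpen_classical_orbit_k8 hcube⟩

theorem mainTheorem7 :
    IsOpen[TwoNilp.zariski ℂ 8] (k8 ℂ).orbit ∧
    IsOpen[TwoNilp.classical ℂ 8] (k8 ℂ).orbit ∧
    IsOpen[TwoNilp.classical ℝ 8] (k8 ℝ).orbit := by
  have isSquare_complex (x : ℂ) : IsSquare x := IsAlgClosed.exists_eq_mul_self x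
  have complex := mainTheorem7_general (K := ℂ) fun x => IsAlgClosed.exists_pow_nat_eq x three_pos
  exact ⟨complex.1 isSquare_complex, complex.2 (Filter.univ_mem' isSquare_complex),
    (mainTheorem7_general surjective_pow_three_real).2 isSquare_mem_nhds_one_real⟩
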